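/- Let $K$ be a field and $d\ge 1$. A $d$-parameter persistence module $X$ over $K$ consists of $K$-vector spaces $X_u$ ($u\in\mathbb R^d$) and linear maps $X_u\to X_v$ for $u\preceq v$ (coordinatewise order), compatible with identities and composition. A line $L:\ s\mapsto b+s\,\mathbf m$ in $\mathbb R^d$ with $\min_i m_i>0$ gives the one-parameter slice $(X_L)_s=X_{b+s\mathbf m}$. If $X_L$ is a direct sum of interval modules of nonempty intervals of $\mathbb R$, its persistence diagram $\mathrm{Dg}\,X_L$ is the multiset of the pairs (left end point, right end point) in $[-\infty,\infty]^2$ of these intervals. The bottleneck distance is $d_B(D,E)=\inf_\mu\sup_x\|x-\mu(x)\|_\infty\in[0,\infty]$, where $\mu$ ranges over all bijections between $D$ and $E$ after countably many copies of each diagonal point $(x,x)$, $x\in\mathbb R$, have been added to both. For two $d$-parameter persistence modules $X,Y$ all of whose slices along such lines have a persistence diagram (are direct sums of interval modules), put \[ d_{match}(X,Y)=\sup_L\ \bigl(\min_i m_i\bigr)\, d_B(\mathrm{Dg}\,X_L,\mathrm{Dg}\,Y_L)\in[0,\infty]. \] The restriction $D^S$ of a diagram $D$ to an interval $S\subseteq\mathbb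 R$ with end points $r_1\le r_2$ in $[-\infty,\infty]$ is the image of $D$ (with multiplicity) under \[ \Pi(b,d)=\begin{cases}(b,d)& r_1\le b\le d\le r_2\\ (b,r_2)& r_1\le b\le r_2\le d\\ (r_1,d)& b\le r_1\le d\le r_2\\ (r_1,r_2)& b\le r_1\le r_2\le d\\ (b,b)& r_2\le b\\ (d,d)& d\le r_1;\end{cases}\] if $S=\emptyset$, then $D^S=\emptyset$. For a box $\mathbb I=I_1\times\cdots\times I_d$, where each $I_i$ is an interval of the real line, let $S_L=\{s: b+s\,\mathbf m\in\mathbb I\}$ and \[ d_{match}(X^{\mathbb I},Y^{\mathbb I})=\sup_L\ \bigl(\min_i m_i\bigr)\, d_B\bigl((\mathrm{Dg}\,X_L)^{S_L},(\mathrm{Dg}\,Y_L)^{S_L}\bigr). \] Then \[ d_{match}(X^{\mathbb I},Y^{\mathbb I})\le d_{match}(X,Y). \] -/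

import Mathlib

open scoped ENNReal DirectSum

universe u v v' w

/-- A persistence module over the field `K` indexed by a preorder `P`: vector spaces `V p` and
transition maps `V p → V q` for `p ≤ q`, compatible with identities and composition.
A `d`-parameter persistence module is the case `P = Fin d → ℝ` with the product order. -/
structure PersistenceModule (K : Type u) [Field K] (P : Type w) [Preorder P] where
  V : P → Type v
  [addCommGroup : ∀ p, AddCommGroup (V p)]
  [module : ∀ p, Module K (V p)]
  map : ∀ {p q : P}, p ≤ q → V p →ₗ[K] V q
  map_id : ∀ p : P, map (le_refl p) = LinearMap.id
  map_comp : ∀ {p q r : P} (hpq : p ≤ q) (hqr : q ≤ r),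
    map hqr ∘ₗ map hpq = map (hpq.trans hqr)

attribute [instance] PersistenceModule.addCommGroup PersistenceModule.module

namespace PersistenceModule

/-- An isomorphism of persistence modules: linear isomorphisms at every index that commute with
the transition maps. -/
structure Iso {K : Type u} [Field K] {P : Type w} [Preorder P]
    (M : PersistenceModule.{u, v, w} K P) (N : PersistenceModule.{u, v', w} K P) where
  equiv : ∀ p, M.V p ≃ₗ[K] N.V p
  naturality : ∀ {p q : P} (h : p ≤ q) (x : M.V p),
    equiv q (M.map h x) = N.map h (equiv p x)

/-- The pullback of a persistence module along a monotone map of the index posets. -/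
def pullback {K : Type u} [Field K] {P : Type w} {Q : Type v'} [Preorder P] [Preorder Q]
    (M : PersistenceModule.{u, v, w} K P) (f : Q → P) (hf : Monotone f) :
    PersistenceModule.{u, v, v'} K Q where
  V q := M.V (f q)
  map h := M.map (hf h)
  map_id q := M.map_id (f q)
  map_comp h h' := M.map_comp (hf h) (hf h')

/-- The direct sum of a family of persistence modules. -/
noncomputable def directSum {K : Type u} [Field K] {P : Type w} [Preorder P] {J : Type v'}
    (M : J → PersistenceModule.{u, v, w} K P) :
    PersistenceModule.{u, max v v', w} K P where
  V p := ⨁ j, (M j).V p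
  map h := DFinsupp.mapRange.linearMap fun j => (M j).map h
  map_id p := by
    refine LinearMap.ext fun x => DFinsupp.ext fun j => ?_
    exact LinearMap.congr_fun ((M j).map_id p) (x j)
  map_comp h h' := by
    refine LinearMap.ext fun x => DFinsupp.ext fun j => ?_
    exact LinearMap.congr_fun ((M j).map_comp h h') (x j)

/-- The value at `t` of the interval module of `S`: all of `K` if `t ∈ S`, and `0` otherwise. -/
def intervalSpace (K : Type u) [Field K] (S : Set ℝ) (t : ℝ) : Submodule K K where
  carrier := {x | x ≠ 0 → t ∈ S}
  zero_mem' h := absurd rfl h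
  add_mem' {x y} hx hy h := by
    by_cases hx0 : x = 0
    · exact hy fun hy0 => h (by rw [hx0, hy0, add_zero])
    · exact hx hx0
  smul_mem' c x hx h := hx fun hx0 => h (by rw [hx0, smul_zero])

open Classical in
/-- The interval module of an interval `S ⊆ ℝ`: it is `K` at the points of `S` and `0` elsewhere,
and its transition maps are the identity between points of `S` and `0` otherwise. -/
noncomputable def interval (K : Type u) [Field K] (S : Set ℝ) (hS : S.OrdConnected) :
    PersistenceModule.{u, u, 0} K ℝ where
  V t := intervalSpace K S t
  map {s t} _ := LinearMap.codRestrict (intervalSpace K S t)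
    ((if t ∈ S then (LinearMap.id : K →ₗ[K] K) else 0) ∘ₗ (intervalSpace K S s).subtype)
    (fun x h => by
      by_contra ht
      simp [ht] at h)
  map_id t := by
    refine LinearMap.ext fun x => Subtype.ext ?_
    by_cases h : t ∈ S
    · simp [h]
    · have hx : (x : K) = 0 := by
        by_contra hx
        exact h (x.2 hx)
      simp [h, hx]
  map_comp {r s t} hrs hst := by
    refine LinearMap.ext fun x => Subtype.ext ?_
    by_cases ht : t ∈ S
    · by_cases hs : s ∈ S
      · simp [ht, hs]
      · have hx : (x : K) = 0 := by
          by_contra hx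
          exact hs (hS.out (x.2 hx) ht ⟨hrs, hst⟩)
        simp [ht, hs, hx]
    · simp [ht]

/-- A decomposition of a one-parameter persistence module as a direct sum of interval modules
of nonempty intervals (of any kind: open, closed, half-open, bounded or not). -/
structure IntervalDecomposition {K : Type u} [Field K]
    (M : PersistenceModule.{u, v, 0} K ℝ) where
  J : Type v
  supp : J → Set ℝ
  ordConnected : ∀ j, (supp j).OrdConnected
  nonempty : ∀ j, (supp j).Nonempty
  iso : Iso M (directSum fun j => interval K (supp j) (ordConnected j))

/-- The one-parameter persistence module `M` is a direct sum of interval modules. -/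
def IntervalDecomposable {K : Type u} [Field K] (M : PersistenceModule.{u, v, 0} K ℝ) : Prop :=
  Nonempty M.IntervalDecomposition

end PersistenceModule

/-- A persistence diagram: a multiset, given as an indexed family, of points `(birth, death)`
in the extended plane with `birth ≤ death`. -/
structure PersistenceDiagram where
  ι : Type v
  birth : ι → EReal
  death : ι → EReal
  birth_le_death : ∀ i, birth i ≤ death i

/-- The left end point in `[-∞, ∞]` of a set of reals. -/
noncomputable def leftEnd (S : Set ℝ) : EReal := ⨅ t ∈ S, (t : EReal)

/-- The right end point in `[-∞, ∞]` of a set of reals. -/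
noncomputable def rightEnd (S : Set ℝ) : EReal := ⨆ t ∈ S, (t : EReal)

theorem leftEnd_le_rightEnd {S : Set ℝ} (hS : S.Nonempty) : leftEnd S ≤ rightEnd S := by
  obtain ⟨t, ht⟩ := hS
  exact (iInf₂_le t ht).trans (le_iSup₂ (f := fun t (_ : t ∈ S) => (t : EReal)) t ht)

/-- The points of the diagram of an interval decomposition are the pairs of end points of
the intervals. -/
noncomputable def PersistenceModule.IntervalDecomposition.diagram {K : Type u} [Field K]
    {M : PersistenceModule.{u, v, 0} K ℝ} (D : M.IntervalDecomposition) :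
    PersistenceDiagram.{v} where
  ι := D.J
  birth j := leftEnd (D.supp j)
  death j := rightEnd (D.supp j)
  birth_le_death j := leftEnd_le_rightEnd (D.nonempty j)

/-- The persistence diagram of an interval decomposable module. (The intervals of a decomposition
are unique up to reindexing, so the choice does not matter.) -/
noncomputable def PersistenceModule.Dg {K : Type u} [Field K]
    (M : PersistenceModule.{u, v, 0} K ℝ) (h : M.IntervalDecomposable) :
    PersistenceDiagram.{v} :=
  (Classical.choice h).diagram

open Classical in
/-- The distance `|x - y|` of extended reals, with `|∞ - ∞| = |(-∞) - (-∞)| = 0`. -/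
noncomputable def extDist (x y : EReal) : ℝ≥0∞ := if x = y then 0 else (x - y).abs

/-- The `L_∞` distance of points of the extended plane. -/
noncomputable def linftyDist (p q : EReal × EReal) : ℝ≥0∞ :=
  max (extDist p.1 q.1) (extDist p.2 q.2)

namespace PersistenceDiagram

/-- The points of a diagram together with countably many copies of every point `(x, x)`, `x : ℝ`,
of the diagonal. -/
noncomputable def point (D : PersistenceDiagram.{v}) : D.ι ⊕ ℝ × ℕ → EReal × EReal
  | Sum.inl i => (D.birth i, D.death i)
  | Sum.inr (x, _) => ((x : EReal), (x : EReal))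

/-- The bottleneck distance: the infimum of `sup_x ‖x - μ x‖_∞` over all bijections `μ` between
the two diagrams, with countably many copies of the diagonal added to each. -/
noncomputable def bottleneckDist (D E : PersistenceDiagram.{v}) : ℝ≥0∞ :=
  ⨅ μ : D.ι ⊕ ℝ × ℕ ≃ E.ι ⊕ ℝ × ℕ, ⨆ x, linftyDist (D.point x) (E.point (μ x))

open Classical in
/-- The projection to the diagram restricted to an interval with end points `r₁ ≤ r₂`, on points
`(b, d)` with `b ≤ d`. Where two cases overlap their values agree. -/
noncomputable def proj (r₁ r₂ b d : EReal) : EReal × EReal :=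
  if r₁ ≤ b ∧ b ≤ d ∧ d ≤ r₂ then (b, d)
  else if r₁ ≤ b ∧ b ≤ r₂ ∧ r₂ ≤ d then (b, r₂)
  else if b ≤ r₁ ∧ r₁ ≤ d ∧ d ≤ r₂ then (r₁, d)
  else if b ≤ r₁ ∧ r₁ ≤ r₂ ∧ r₂ ≤ d then (r₁, r₂)
  else if r₂ ≤ b then (b, b)
  else (d, d)

theorem proj_fst_le_snd (r₁ r₂ b d : EReal) : (proj r₁ r₂ b d).1 ≤ (proj r₁ r₂ b d).2 := by
  unfold proj
  split_ifs <;> simp_all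

/-- The empty diagram. -/
def empty : PersistenceDiagram.{v} where
  ι := PEmpty
  birth := PEmpty.elim
  death := PEmpty.elim
  birth_le_death i := i.elim

open Classical in
/-- The restriction of a diagram to an interval `S` of the real line. It is the image under the
projection if `S` is nonempty, and empty if `S` is empty. -/
noncomputable def restrict (D : PersistenceDiagram.{v}) (S : Set ℝ) : PersistenceDiagram.{v} :=
  if S.Nonempty then
    { ι := D.ι
      birth := fun i => (proj (leftEnd S) (rightEnd S) (D.birth i) (D.death i)).1
      death := fun i => (proj (leftEnd S) (rightEnd S) (D.birth i) (D.death i)).2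
      birth_le_death := fun _ => proj_fst_le_snd _ _ _ _ }
  else empty

end PersistenceDiagram

/-- A line `s ↦ base + s • dir` in `ℝ^d` all of whose direction coordinates are positive.
(Rescaling `dir` by `c > 0` divides all coordinates `s` by `c` and multiplies `minDir` by `c`, so
the terms of the matching distance below depend only on the line as a set.) -/
structure PositiveLine (d : ℕ) where
  dir : Fin d → ℝ
  base : Fin d → ℝ
  dir_pos : ∀ i, 0 < dir i

namespace PositiveLine

/-- The point of the line with parameter `s`. -/
def param {d : ℕ} (L : PositiveLine d) (s : ℝ) : Fin d → ℝ := fun i => L.base i + s * L.dir i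

theorem monotone_param {d : ℕ} (L : PositiveLine d) : Monotone L.param := fun _ _ h i =>
  add_le_add_right (mul_le_mul_of_nonneg_right h (L.dir_pos i).le) (L.base i)

/-- The smallest coordinate of the direction of the line. -/
noncomputable def minDir {d : ℕ} [NeZero d] (L : PositiveLine d) : ℝ :=
  Finset.univ.inf' Finset.univ_nonempty L.dir

end PositiveLine

/-- The one-parameter slice `X_L` of a `d`-parameter persistence module along a line `L`. -/
def PersistenceModule.slice {K : Type u} [Field K] {d : ℕ}
    (X : PersistenceModule.{u, v, 0} K (Fin d → ℝ)) (L : PositiveLine d) :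
    PersistenceModule.{u, v, 0} K ℝ :=
  X.pullback L.param L.monotone_param

/-- The matching distance `sup_L (min_i m_i) d_B(Dg X_L, Dg Y_L)` of two `d`-parameter
persistence modules all of whose slices have a persistence diagram. -/
noncomputable def matchingDist {K : Type u} [Field K] {d : ℕ} [NeZero d]
    (X Y : PersistenceModule.{u, v, 0} K (Fin d → ℝ))
    (hX : ∀ L, (X.slice L).IntervalDecomposable) (hY : ∀ L, (Y.slice L).IntervalDecomposable) :
    ℝ≥0∞ :=
  ⨆ L : PositiveLine d, ENNReal.ofReal L.minDir *
    ((X.slice L).Dg (hX L)).bottleneckDist ((Y.slice L).Dg (hY L))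

/-- The matching distance restricted to the region `B ⊆ ℝ^d`: the diagrams of the slices along `L`
are restricted to the parameters for which `L` lies in `B`. -/
noncomputable def restrictedMatchingDist {K : Type u} [Field K] {d : ℕ} [NeZero d]
    (X Y : PersistenceModule.{u, v, 0} K (Fin d → ℝ))
    (hX : ∀ L, (X.slice L).IntervalDecomposable) (hY : ∀ L, (Y.slice L).IntervalDecomposable)
    (B : Set (Fin d → ℝ)) : ℝ≥0∞ :=
  ⨆ L : PositiveLine d, ENNReal.ofReal L.minDir *
    (((X.slice L).Dg (hX L)).restrict (L.param ⁻¹' B)).bottleneckDist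
      (((Y.slice L).Dg (hY L)).restrict (L.param ⁻¹' B))

/-! Restricting diagrams to an interval does not increase the bottleneck distance, and the claim
follows by taking suprema over lines. For `b ≤ d` and `r₁ ≤ r₂` the six cases of the projection
combine into the single formula `Π(b, d) = (max b (min d r₁), min d (max b r₂))` (`proj_eq`). As
`max` and `min` are `1`-Lipschitz for the sup distance (`extDist_max_max_le`,
`extDist_min_min_le`), so is `Π` (`linftyDist_proj_proj_le`). Moreover `Π` fixes the diagonal. Hence
a matching of two diagrams, with the diagonal added, is also a matching of their restrictions, of
no larger cost (`bottleneckDist_restrict_le`). -/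

/-- Closeness of extended reals as a pair of order relations: infinite values are at finite
distance only from themselves. -/
theorem extDist_le_coe_iff (x y : EReal) (e : NNReal) :
    extDist x y ≤ e ↔ x ≤ y + ((e : ℝ) : EReal) ∧ y ≤ x + ((e : ℝ) : EReal) := by
  unfold extDist
  induction x <;> induction y
  all_goals try simp
  case coe.coe x y =>
    have key : (if x = y then 0 else ((x : EReal) - y).abs) = ENNReal.ofReal |x - y| := by
      split_ifs with h
      · simp [h]
      · rw [← EReal.coe_sub, EReal.abs_def]
    rw [key, ENNReal.ofReal_le_iff_le_toReal ENNReal.coe_ne_top, ENNReal.coe_toReal, abs_le]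
    norm_cast
    constructor <;> rintro ⟨h₁, h₂⟩ <;> constructor <;> linarith
  all_goals
    rw [← EReal.coe_add]
    exact EReal.coe_ne_top _

theorem extDist_self (x : EReal) : extDist x x = 0 := if_pos rfl

theorem extDist_max_max_le (a b c d : EReal) :
    extDist (max a b) (max c d) ≤ max (extDist a c) (extDist b d) := by
  rcases h : max (extDist a c) (extDist b d) with _ | e
  · exact le_top
  · obtain ⟨hac, hbd⟩ := max_le_iff.1 (le_of_eq h)
    obtain ⟨h₁, h₂⟩ := (extDist_le_coe_iff a c e).1 hac
    obtain ⟨h₃, h₄⟩ := (extDist_le_coe_iff b d e).1 hbd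
    refine (extDist_le_coe_iff _ _ e).2 ?_
    have hm : Monotone fun x : EReal => x + ((e : ℝ) : EReal) := fun _ _ h => add_le_add h le_rfl
    exact ⟨(max_le_max h₁ h₃).trans_eq hm.map_max.symm, (max_le_max h₂ h₄).trans_eq hm.map_max.symm⟩

theorem extDist_min_min_le (a b c d : EReal) :
    extDist (min a b) (min c d) ≤ max (extDist a c) (extDist b d) := by
  rcases h : max (extDist a c) (extDist b d) with _ | e
  · exact le_top
  · obtain ⟨hac, hbd⟩ := max_le_iff.1 (le_of_eq h)
    obtain ⟨h₁, h₂⟩ := (extDist_le_coe_iff a c e).1 hac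
    obtain ⟨h₃, h₄⟩ := (extDist_le_coe_iff b d e).1 hbd
    refine (extDist_le_coe_iff _ _ e).2 ?_
    have hm : Monotone fun x : EReal => x + ((e : ℝ) : EReal) := fun _ _ h => add_le_add h le_rfl
    exact ⟨(min_le_min h₁ h₃).trans_eq hm.map_min.symm, (min_le_min h₂ h₄).trans_eq hm.map_min.symm⟩

namespace PersistenceDiagram

theorem proj_eq {r₁ r₂ b d : EReal} (hr : r₁ ≤ r₂) (h : b ≤ d) :
    proj r₁ r₂ b d = (max b (min d r₁), min d (max b r₂)) := by
  unfold proj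
  split_ifs <;> ext <;> grind

theorem linftyDist_proj_proj_le {r₁ r₂ b d b' d' : EReal} (hr : r₁ ≤ r₂) (h : b ≤ d)
    (h' : b' ≤ d') :
    linftyDist (proj r₁ r₂ b d) (proj r₁ r₂ b' d') ≤ linftyDist (b, d) (b', d') := by
  rw [proj_eq hr h, proj_eq hr h']
  refine max_le ?_ ?_
  · refine (extDist_max_max_le _ _ _ _).trans (max_le_max le_rfl ?_)
    simpa [extDist_self] using extDist_min_min_le d r₁ d' r₁
  · refine (extDist_min_min_le _ _ _ _).trans ?_
    rw [max_comm]
    refine max_le_max ?_ le_rfl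
    simpa [extDist_self] using extDist_max_max_le b r₂ b' r₂

theorem proj_diag {r₁ r₂ : EReal} (hr : r₁ ≤ r₂) (x : EReal) : proj r₁ r₂ x x = (x, x) := by
  rw [proj_eq hr le_rfl]
  simp

theorem bottleneckDist_self (D : PersistenceDiagram.{v}) : D.bottleneckDist D = 0 := by
  refine le_antisymm (iInf_le_of_le (Equiv.refl _) (iSup_le fun x => ?_)) bot_le
  simp [linftyDist, extDist_self]

theorem bottleneckDist_restrict_le (D E : PersistenceDiagram.{v}) (S : Set ℝ) :
    (D.restrict S).bottleneckDist (E.restrict S) ≤ D.bottleneckDist E := by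
  by_cases hS : S.Nonempty
  · have hr := leftEnd_le_rightEnd hS
    simp only [restrict, if_pos hS]
    refine le_iInf fun μ => iInf_le_of_le μ (iSup_mono fun x => ?_)
    have fst_le_snd : ∀ (F : PersistenceDiagram.{v}) (y : F.ι ⊕ ℝ × ℕ),
        (F.point y).1 ≤ (F.point y).2 := by
      rintro F (i | ⟨x, n⟩)
      · exact F.birth_le_death i
      · exact le_rfl
    -- Since the projection fixes the diagonal, every point of a restricted diagram, added diagonal
    -- points included, is the projection of the corresponding point of the original diagram.
    refine le_trans (le_of_eq ?_)
      (linftyDist_proj_proj_le hr (fst_le_snd D x) (fst_le_snd E (μ x)))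
    congr 1
    · rcases x with i | ⟨x, n⟩
      · rfl
      · exact (proj_diag hr _).symm
    · rcases μ x with i | ⟨x, n⟩
      · rfl
      · exact (proj_diag hr _).symm
  · simp only [restrict, if_neg hS, bottleneckDist_self]
    exact bot_le

end PersistenceDiagram

theorem corollary4 {K : Type u} [Field K] {d : ℕ} [NeZero d]
    (X Y : PersistenceModule.{u, v, 0} K (Fin d → ℝ))
    (hX : ∀ L : PositiveLine d, (X.slice L).IntervalDecomposable)
    (hY : ∀ L : PositiveLine d, (Y.slice L).IntervalDecomposable)
    (I : Fin d → Set ℝ) (hI : ∀ i, (I i).OrdConnected) :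
    restrictedMatchingDist X Y hX hY (Set.univ.pi I) ≤ matchingDist X Y hX hY :=
  iSup_mono fun _ => mul_le_mul_right (PersistenceDiagram.bottleneckDist_restrict_le _ _ _) _
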